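/- Let $h\colon\mathbb{R}^m\to[-\infty,+\infty]$ be lower semicontinuous and convex, and let $c\colon\mathbb{R}^n\to\mathbb{R}^m$ be continuously differentiable. For an extended-real-valued function $f$ and a point $x$ with $f(x)$ finite, let $\hat\partial f(x)$ be the set of regular subgradients, i.e. of $v$ with $f(y)\ge f(x)+\langle v,y-x\rangle+o(|y-x|)$ as $y\to x$; let the subdifferential $\partial f(x)$ be the set of limits of $v_k\in\hat\partial f(y_k)$ with $y_k\to x$, $f(y_k)\to f(x)$; and let the horizon subdifferential $\partial^\infty f(x)$ be the set of limits of $t_kv_k$ with $v_k\in\hat\partial f(y_k)$, $y_k\to x$, $f(y_k)\to f(x)$, $t_k>0$, $t_k\to0$. All three sets are empty where $f$ is not finite. Let $\bar x\in\mathbb{R}^n$ be critical for $h\circ c$, i.e. $0\in\partial(h\circ c)(\bar x)$, and suppose that $$\partial^\infty h(c(\bar x))\cap\{w\in\mathbb{R}^m:\nabla c(\bar x)^*w=0\}=\{0\}.$$ Suppose that there is exactly one multiplier vector for $\bar x$, i.e. exactly one $\bar v\in\partial h(c(\bar x))$ with $\nabla c(\bar x)^*\bar v=0$, and that $\bar v$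 lies in the relative interior of $\partial h(c(\bar x))$. Let $\mathcal{M}\subset\mathbb{R}^m$ be a closed set, and suppose that $h$ is partly smooth at $\bar c=c(\bar x)$ relative to $\mathcal{M}$, meaning: $\bar c\in\mathcal{M}$; $\mathcal{M}$ is a $C^2$ manifold around $\bar c$ (near $\bar c$ it is the zero set of a $C^2$ map $F$ into some $\mathbb{R}^k$ with $\nabla F(\bar c)$ surjective); the restriction $h|_{\mathcal{M}}$ is $C^2$ around $\bar c$; the set-valued mapping $\partial h$, restricted to $\mathcal{M}$, is continuous (outer and inner semicontinuous, in the sense of Painlevé–Kuratowski) at $\bar c$; and the affine span of $\partial h(\bar c)$ is a translate of the normal space to $\mathcal{M}$ at $\bar c$. Then for any sequences of points $x_r\in\mathbb{R}^n$, vectors $c_r\in\mathbb{R}^m$ and subgradients $v_r\in\partial h(c_r)$ ($r=1,2,\ldots$) satisfying $$x_r\to\bar x,\qquad |c_r-c(x_r)|\to0,\qquad h(c_r)\to h(c(\bar x)),\qquad \nabla c(x_r)^*v_r\to0$$ as $r\to\infty$, we have $c_r\in\mathcal{M}$ for all sufficiently large $r$. -/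

import Mathlib

open Filter Topology

namespace CompositeOpt

/-- The space `ℝⁿ` with its Euclidean structure. -/
abbrev E (n : ℕ) : Type := EuclideanSpace ℝ (Fin n)

/-- Convexity of an extended-real-valued function: its epigraph is convex. -/
def ConvexFun {n : ℕ} (f : E n → EReal) : Prop :=
  Convex ℝ {p : E n × ℝ | f p.1 ≤ (p.2 : EReal)}

/-- Regular (Fréchet) subgradients at `x`: `f x` is finite and
`f y ≥ f x + ⟪v, y - x⟫ + o(‖y - x‖)`. The set is empty where `f` is not finite. -/
def regularSubdiff {n : ℕ} (f : E n → EReal) (x : E n) : Set (E n) :=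
  {v | ∃ a : ℝ, f x = (a : EReal) ∧ ∀ ε : ℝ, 0 < ε → ∀ᶠ y in 𝓝 x,
    ((a + inner ℝ v (y - x) - ε * ‖y - x‖ : ℝ) : EReal) ≤ f y}

/-- The (limiting) subdifferential `∂f(x)`: limits of regular subgradients `u k` at points `y k`
with `y k → x` and `f (y k) → f x`. The set is empty where `f` is not finite. -/
def subdiff {n : ℕ} (f : E n → EReal) (x : E n) : Set (E n) :=
  {v | (∃ a : ℝ, f x = (a : EReal)) ∧ ∃ (y u : ℕ → E n),
    Tendsto y atTop (𝓝 x) ∧ Tendsto (fun k => f (y k)) atTop (𝓝 (f x)) ∧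
    (∀ k, u k ∈ regularSubdiff f (y k)) ∧ Tendsto u atTop (𝓝 v)}

/-- The horizon subdifferential `∂^∞ f(x)`: limits of `t k • u k` with `u k` regular subgradients
at points `y k` with `y k → x`, `f (y k) → f x`, and scalars `t k > 0` tending to `0`. -/
def horizonSubdiff {n : ℕ} (f : E n → EReal) (x : E n) : Set (E n) :=
  {v | (∃ a : ℝ, f x = (a : EReal)) ∧ ∃ (y u : ℕ → E n) (t : ℕ → ℝ),
    Tendsto y atTop (𝓝 x) ∧ Tendsto (fun k => f (y k)) atTop (𝓝 (f x)) ∧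
    (∀ k, u k ∈ regularSubdiff f (y k)) ∧ (∀ k, 0 < t k) ∧ Tendsto t atTop (𝓝 0) ∧
    Tendsto (fun k => t k • u k) atTop (𝓝 v)}

/-- `x` is critical for `f`: `0 ∈ ∂f(x)`. -/
def IsCritical {n : ℕ} (f : E n → EReal) (x : E n) : Prop :=
  (0 : E n) ∈ subdiff f x

/-- The adjoint `∇c(x)^* : ℝᵐ → ℝⁿ` of the derivative of `c` at `x`. -/
noncomputable def gradAdj {n m : ℕ} (c : E n → E m) (x : E n) : E m →L[ℝ] E n :=
  ContinuousLinearMap.adjoint (fderiv ℝ c x)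

/-- `v` is a multiplier vector for `x`: `v ∈ ∂h(c(x))` and `∇c(x)^* v = 0`. -/
def IsMultiplier {n m : ℕ} (h : E m → EReal) (c : E n → E m) (x : E n) (v : E m) : Prop :=
  v ∈ subdiff h (c x) ∧ gradAdj c x v = 0

/-- Outer limit of the set-valued map `S` at `p` relative to `M`. -/
def outerLimit {m : ℕ} (S : E m → Set (E m)) (M : Set (E m)) (p : E m) : Set (E m) :=
  {v | ∃ (q u : ℕ → E m), (∀ k, q k ∈ M) ∧ Tendsto q atTop (𝓝 p) ∧
    (∀ k, u k ∈ S (q k)) ∧ Tendsto u atTop (𝓝 v)}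

/-- Inner limit of the set-valued map `S` at `p` relative to `M`. -/
def innerLimit {m : ℕ} (S : E m → Set (E m)) (M : Set (E m)) (p : E m) : Set (E m) :=
  {v | ∀ q : ℕ → E m, (∀ k, q k ∈ M) → Tendsto q atTop (𝓝 p) →
    ∃ u : ℕ → E m, (∀ᶠ k in atTop, u k ∈ S (q k)) ∧ Tendsto u atTop (𝓝 v)}

/-- Continuity (in the sense of Painlevé–Kuratowski) of the set-valued map `S` at `p`
relative to `M`: outer and inner semicontinuity. -/
def SetContinuousWithinAt {m : ℕ} (S : E m → Set (E m)) (M : Set (E m)) (p : E m) : Prop :=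
  outerLimit S M p ⊆ S p ∧ S p ⊆ innerLimit S M p

/-- `F` is a local `C²` defining map of `M` around `p`: near `p`, the set `M` is the zero set
of `F`, and `F` is `C²` around `p` with surjective derivative at `p`. -/
def IsDefiningMap {m k : ℕ} (F : E m → E k) (M : Set (E m)) (p : E m) : Prop :=
  ContDiffAt ℝ 2 F p ∧ Function.Surjective (fderiv ℝ F p) ∧ ∀ᶠ q in 𝓝 p, (q ∈ M ↔ F q = 0)

/-- The normal space at `p` of the manifold locally defined by `F = 0`: the orthogonal complement
of the tangent space `ker ∇F(p)`. It depends only on the manifold, not on the choice of `F`. -/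
noncomputable def normalSpace {m k : ℕ} (F : E m → E k) (p : E m) : Submodule ℝ (E m) :=
  (LinearMap.ker (fderiv ℝ F p).toLinearMap)ᗮ

/-- Partial smoothness of a (lower semicontinuous, convex) function `h` at `p` relative to `M`:
`p ∈ M`, `M` is a `C²` manifold around `p`, `h` restricted to `M` is `C²` around `p`
(it agrees on `M` near `p` with a function that is `C²` around `p`), `∂h` is continuous at `p`
relative to `M`, and the affine span of `∂h(p)` is a translate of the normal space to `M` at `p`. -/
def PartlySmoothAt {m : ℕ} (h : E m → EReal) (M : Set (E m)) (p : E m) : Prop :=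
  p ∈ M ∧
  (∃ g : E m → ℝ, ContDiffAt ℝ 2 g p ∧ ∀ᶠ q in 𝓝[M] p, h q = (g q : EReal)) ∧
  SetContinuousWithinAt (subdiff h) M p ∧
  ∃ (k : ℕ) (F : E m → E k), IsDefiningMap F M p ∧
    ∃ a : E m, affineSpan ℝ (subdiff h p) = AffineSubspace.mk' a (normalSpace F p)

end CompositeOpt

/-! The subgradients `v r` are bounded: otherwise their normalizations cluster at a unit horizon
subgradient killed by `∇c(x̄)^*`, which transversality excludes. Every cluster point is a
multiplier, so by uniqueness `v r → v̄` (`ConvexFun.tendsto_multiplier`).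

Identification (`PartlySmoothAt.eventually_mem`) is then by contradiction. If `c r ∉ M` infinitely
often, project to nearest points `q r ∈ M`; along a subsequence the unit vectors along `c r - q r`
tend to some `d` normal to `M`. As `v̄` is relatively interior and the affine span of `∂h(c̄)` is
parallel to the normal space, `v̄ + ε d ∈ ∂h(c̄)` for some `ε > 0`, and inner semicontinuity gives
`u r ∈ ∂h(q r)` tending to it. Monotonicity of `∂h` makes the pairing of `v r - u r` with the unit
vectors nonnegative, yet its limit is `-ε‖d‖² = -ε`. -/

namespace CompositeOpt

/-! ### Subgradients of convex functions -/

section ConvexSubgradients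

variable {m : ℕ} {h : E m → EReal}

/-- A regular subgradient of a convex function satisfies the global subgradient inequality. -/
theorem ConvexFun.add_inner_le_of_mem_regularSubdiff (hconv : ConvexFun h) {p v : E m}
    (hv : v ∈ regularSubdiff h p) {a : ℝ} (ha : h p = a) {q : E m} {b : ℝ}
    (hb : h q ≤ (b : EReal)) : a + inner ℝ v (q - p) ≤ b := by
  obtain ⟨a', ha', hev⟩ := hv
  obtain rfl : a = a' := by exact_mod_cast ha.symm.trans ha'
  refine le_of_forall_pos_le_add fun δ hδ => ?_
  set ε : ℝ := δ / (‖q - p‖ + 1)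
  have hn : 0 < ‖q - p‖ + 1 := by positivity
  have hε : 0 < ε := div_pos hδ hn
  have hεδ : ε * ‖q - p‖ ≤ δ := by
    calc ε * ‖q - p‖ ≤ ε * (‖q - p‖ + 1) := by gcongr; linarith
      _ = δ := div_mul_cancel₀ _ hn.ne'
  have hcurve : Tendsto (fun t : ℝ => p + t • (q - p)) (𝓝[>] 0) (𝓝 p) := by
    have : Continuous fun t : ℝ => p + t • (q - p) := by fun_prop
    simpa using (this.tendsto 0).mono_left nhdsWithin_le_nhds
  -- One point of the segment near `p` suffices: there the local lower bound meets the convexity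
  -- upper bound, and `t` cancels.
  obtain ⟨t, ht, ⟨ht0, ht1⟩⟩ :=
    ((hcurve.eventually (hev ε hε)).and (Ioo_mem_nhdsGT (zero_lt_one (α := ℝ)))).exists
  have hmem := hconv (x := (p, a)) (y := (q, b)) ha.le hb
    (sub_nonneg.2 ht1.le) ht0.le (sub_add_cancel 1 t)
  have hpt : (1 - t) • p + t • q = p + t • (q - p) := by module
  have hmem' : h (p + t • (q - p)) ≤ (((1 - t) * a + t * b : ℝ) : EReal) := by
    rw [← hpt]; exact hmem
  have hle := EReal.coe_le_coe_iff.1 (ht.trans hmem')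
  rw [add_sub_cancel_left, inner_smul_right, norm_smul, Real.norm_of_nonneg ht0.le] at hle
  have : t * (a + inner ℝ v (q - p)) ≤ t * (b + ε * ‖q - p‖) := by linarith
  linarith [le_of_mul_le_mul_left this ht0]

/-- A limiting subgradient of a convex function satisfies the global subgradient inequality. -/
theorem ConvexFun.add_inner_le_of_mem_subdiff (hconv : ConvexFun h) {p v : E m}
    (hv : v ∈ subdiff h p) {a : ℝ} (ha : h p = a) {q : E m} {b : ℝ}
    (hb : h q ≤ (b : EReal)) : a + inner ℝ v (q - p) ≤ b := by
  obtain ⟨-, y, u, hy, hhy, hu, huv⟩ := hv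
  choose α hα hu' using hu
  have hα_lim : Tendsto α atTop (𝓝 a) := by
    rw [← EReal.tendsto_coe]
    simpa only [hα, ha] using hhy
  refine le_of_tendsto (hα_lim.add (huv.inner (tendsto_const_nhds.sub hy)))
    (Eventually.of_forall fun k => ?_)
  exact hconv.add_inner_le_of_mem_regularSubdiff ⟨α k, hα k, hu' k⟩ (hα k) hb

/-- For convex functions, limiting subgradients are regular. -/
theorem ConvexFun.subdiff_subset_regularSubdiff (hconv : ConvexFun h) (p : E m) :
    subdiff h p ⊆ regularSubdiff h p := by
  intro v hv
  obtain ⟨a, ha⟩ := hv.1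
  refine ⟨a, ha, fun ε hε => Eventually.of_forall fun y => ?_⟩
  -- `h y` may be infinite, so it is compared through real numbers above it.
  refine EReal.le_of_forall_lt_iff_le.1 fun b hb => ?_
  have := hconv.add_inner_le_of_mem_subdiff hv ha hb.le
  have : 0 ≤ ε * ‖y - p‖ := by positivity
  exact_mod_cast (by linarith : a + inner ℝ v (y - p) - ε * ‖y - p‖ ≤ b)

/-- The subdifferential of a convex function is monotone. -/
theorem ConvexFun.subdiff_monotone (hconv : ConvexFun h) {p q u v : E m}
    (hu : u ∈ subdiff h p) (hv : v ∈ subdiff h q) : 0 ≤ inner ℝ (v - u) (q - p) := by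
  obtain ⟨a, ha⟩ := hu.1
  obtain ⟨b, hb⟩ := hv.1
  have h₁ := hconv.add_inner_le_of_mem_subdiff hu ha hb.le
  have h₂ := hconv.add_inner_le_of_mem_subdiff hv hb ha.le
  rw [← neg_sub q p, inner_neg_right] at h₂
  rw [inner_sub_left]
  linarith

end ConvexSubgradients

theorem tendsto_clm_apply {m k : ℕ} {B : ℕ → E m →L[ℝ] E k} {A : E m →L[ℝ] E k} {y : ℕ → E m}
    {z : E m} (hB : Tendsto B atTop (𝓝 A)) (hy : Tendsto y atTop (𝓝 z)) :
    Tendsto (fun r => B r (y r)) atTop (𝓝 (A z)) :=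
  ((isBoundedBilinearMap_apply (𝕜 := ℝ) (E := E m) (F := E k)).continuous.tendsto (A, z)).comp
    (hB.prodMk_nhds hy)

/-! ### Proximal normals to the manifold -/

section NormalVectors

variable {m k : ℕ} {F : E m → E k} {M : Set (E m)} {p : E m}

/-- At a nearest point `p` of `c` in `M`, the vector `c - p` is orthogonal to the tangent space. -/
theorem inner_eq_zero_of_nearest (hM : ∀ᶠ q in 𝓝 p, (q ∈ M ↔ F q = 0)) (hp : p ∈ M)
    {A : E m →L[ℝ] E k} (hF : HasStrictFDerivAt F A p) (hA : Function.Surjective A)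
    {c : E m} (hmin : ∀ q ∈ M, dist c p ≤ dist c q) {z : E m} (hz : A z = 0) :
    inner ℝ (c - p) z = 0 := by
  have hFp : F p = 0 := hM.self_of_nhds.1 hp
  have hext : IsLocalExtrOn (fun q => ‖q - c‖ ^ 2) {q | F q = F p} p := by
    refine Or.inl ?_
    filter_upwards [self_mem_nhdsWithin, mem_nhdsWithin_of_mem_nhds hM] with q hq hqM
    have := hmin q (hqM.2 (hq.trans hFp))
    rw [dist_comm c p, dist_comm c q, dist_eq_norm, dist_eq_norm] at this
    gcongr
  have hφ : HasStrictFDerivAt (fun q : E m => ‖q - c‖ ^ 2)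
      ((2 : ℝ) • (innerSL ℝ (p - c)).comp (ContinuousLinearMap.id ℝ (E m))) p := by
    exact_mod_cast (hasStrictFDerivAt_norm_sq (p - c)).comp p
      ((hasStrictFDerivAt_id p).sub_const c)
  obtain ⟨Λ, Λ₀, hne, hΛ⟩ := hext.exists_linear_map_of_hasStrictFDerivAt hF hφ
  -- Surjectivity of `A` rules out the degenerate Lagrange multiplier.
  have hΛ₀ : Λ₀ ≠ 0 := by
    rintro rfl
    refine hne (Prod.ext (LinearMap.ext fun y => ?_) rfl)
    obtain ⟨x, rfl⟩ := hA y
    simpa using hΛ x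
  have := hΛ z
  rw [hz, map_zero, zero_add] at this
  have h0 : inner ℝ (p - c) z = 0 := by simpa [hΛ₀, inner_sub_left] using this
  rw [← neg_sub p c, inner_neg_left, h0, neg_zero]

/-- A kernel vector of a surjective `A` is a limit of kernel vectors of surjective maps
converging to `A`. -/
theorem exists_tendsto_mem_ker {A : E m →L[ℝ] E k} (hA : Function.Surjective A)
    {B : ℕ → E m →L[ℝ] E k} (hB : Tendsto B atTop (𝓝 A)) {z : E m} (hz : A z = 0) :
    ∃ y : ℕ → E m, Tendsto y atTop (𝓝 z) ∧
      ∀ᶠ r in atTop, Function.Surjective (B r) ∧ B r (y r) = 0 := by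
  obtain ⟨R, hR⟩ := A.exists_rightInverse_of_surjective (LinearMap.range_eq_top.2 hA)
  have hBR : Tendsto (fun r => (B r).comp R) atTop (𝓝 (1 : E k →L[ℝ] E k)) := by
    have : Continuous fun T : E m →L[ℝ] E k => T.comp R := by fun_prop
    have hlim := (this.tendsto A).comp hB
    rw [hR] at hlim
    exact hlim
  have hinv : Tendsto (fun r => Ring.inverse ((B r).comp R)) atTop (𝓝 (1 : E k →L[ℝ] E k)) := by
    have := (NormedRing.inverse_continuousAt (1 : (E k →L[ℝ] E k)ˣ)).tendsto
    rw [Units.val_one, Ring.inverse_one] at this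
    exact this.comp hBR
  -- `B r ∘ R` is close to the identity, hence eventually invertible, so `R ∘ (B r ∘ R)⁻¹` is a
  -- right inverse of `B r`; subtracting its value at `B r z` moves `z` into the kernel.
  refine ⟨fun r => z - R (Ring.inverse ((B r).comp R) (B r z)), ?_, ?_⟩
  · have hBz : Tendsto (fun r => B r z) atTop (𝓝 0) := by
      simpa [hz] using tendsto_clm_apply hB (tendsto_const_nhds (x := z))
    have := (R.continuous.tendsto _).comp (tendsto_clm_apply hinv hBz)
    simpa using (tendsto_const_nhds (x := z)).sub this
  · filter_upwards [hBR.eventually (Units.isOpen.mem_nhds isUnit_one)] with r hr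
    have hcancel (w : E k) : B r (R (Ring.inverse ((B r).comp R) w)) = w :=
      DFunLike.congr_fun (Ring.mul_inverse_cancel _ hr) w
    exact ⟨fun w => ⟨_, hcancel w⟩, by rw [map_sub, hcancel, sub_self]⟩

/-- Limits of scaled proximal normals `s r • (c r - q r)`, with `q r` a nearest point of `c r`
in `M` and `q r → p`, lie in the normal space at `p`. -/
theorem IsDefiningMap.mem_normalSpace_of_tendsto (hF : IsDefiningMap F M p)
    {c q : ℕ → E m} {s : ℕ → ℝ} {d : E m} (hqM : ∀ r, q r ∈ M)
    (hmin : ∀ r, ∀ y ∈ M, dist (c r) (q r) ≤ dist (c r) y)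
    (hq : Tendsto q atTop (𝓝 p)) (hd : Tendsto (fun r => s r • (c r - q r)) atTop (𝓝 d)) :
    d ∈ normalSpace F p := by
  obtain ⟨hsm, hsurj, hM⟩ := hF
  rw [normalSpace, Submodule.mem_orthogonal']
  intro z hz
  have hcont : ContinuousAt (fderiv ℝ F) p :=
    (hsm.fderiv_right (m := 1) (by norm_num)).continuousAt
  obtain ⟨y, hy, hker⟩ := exists_tendsto_mem_ker hsurj (hcont.tendsto.comp hq)
    (z := z) (by simpa using hz)
  refine tendsto_nhds_unique_of_eventuallyEq (hd.inner hy) tendsto_const_nhds ?_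
  filter_upwards [hker, hq.eventually (hsm.eventually (by simp)),
    hq.eventually hM.eventually_nhds] with r ⟨hsr, hyr⟩ hFr hMr
  rw [inner_smul_left, inner_eq_zero_of_nearest hMr (hqM r)
    (hFr.hasStrictFDerivAt (by norm_num)) hsr (hmin r) hyr, mul_zero]

end NormalVectors

/-- From a relative interior point one may move a little in any direction of the affine span. -/
theorem exists_pos_add_smul_mem_of_mem_intrinsicInterior {m : ℕ} {S : Set (E m)} {v d : E m}
    (hv : v ∈ intrinsicInterior ℝ S) (hd : d ∈ (affineSpan ℝ S).direction) :
    ∃ ε : ℝ, 0 < ε ∧ v + ε • d ∈ S := by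
  obtain ⟨w, hw, rfl⟩ := mem_intrinsicInterior.1 hv
  have hmem (t : ℝ) : (w : E m) + t • d ∈ affineSpan ℝ S := by
    rw [add_comm]
    exact AffineSubspace.vadd_mem_of_mem_direction (Submodule.smul_mem _ t hd) w.2
  -- The line is taken inside the affine span, where relative interior is ordinary interior.
  have hcont : Continuous fun t : ℝ => (⟨(w : E m) + t • d, hmem t⟩ : affineSpan ℝ S) := by
    fun_prop
  have hnhds : ∀ᶠ t : ℝ in 𝓝 0, (w : E m) + t • d ∈ S :=
    hcont.continuousAt.preimage_mem_nhds (t := ((↑) : affineSpan ℝ S → E m) ⁻¹' S)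
      (by simpa using mem_interior_iff_mem_nhds.1 hw)
  obtain ⟨ε, hε, hpos⟩ :=
    ((hnhds.filter_mono (nhdsWithin_le_nhds (s := Set.Ioi 0))).and self_mem_nhdsWithin).exists
  exact ⟨ε, hpos, hε⟩

/-- Identification for convex partly smooth functions: if subgradients `v r` at `c r → p` converge
to a relative interior point of the subdifferential at `p`, then `c r` eventually lies in the
active manifold. -/
theorem PartlySmoothAt.eventually_mem {m : ℕ} {h : E m → EReal} {M : Set (E m)} {p vbar : E m}
    (hps : PartlySmoothAt h M p) (hconv : ConvexFun h) (hM : IsClosed M)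
    (hri : vbar ∈ intrinsicInterior ℝ (subdiff h p)) {c v : ℕ → E m}
    (hv : ∀ r, v r ∈ subdiff h (c r)) (hc : Tendsto c atTop (𝓝 p))
    (hvlim : Tendsto v atTop (𝓝 vbar)) : ∀ᶠ r in atTop, c r ∈ M := by
  obtain ⟨hpM, -, ⟨-, hinner⟩, k, F, hF, a, hspan⟩ := hps
  by_contra hcon
  obtain ⟨φ, hφ, hφM⟩ := extraction_of_frequently_atTop (not_eventually.1 hcon)
  choose q hqM hq using fun r => hM.exists_infDist_eq_dist ⟨p, hpM⟩ (c (φ r))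
  have hmin (r : ℕ) (y : E m) (hy : y ∈ M) : dist (c (φ r)) (q r) ≤ dist (c (φ r)) y :=
    (hq r).ge.trans (Metric.infDist_le_dist_of_mem hy)
  have hcφ := hc.comp hφ.tendsto_atTop
  have hqlim : Tendsto q atTop (𝓝 p) := by
    have hcp : Tendsto (fun r => dist (c (φ r)) p) atTop (𝓝 0) :=
      tendsto_iff_dist_tendsto_zero.1 hcφ
    rw [tendsto_iff_dist_tendsto_zero]
    -- Since `p` competes in the projection, `q r` is at most twice as far from `p` as `c (φ r)` is.
    refine squeeze_zero (fun _ => dist_nonneg) (fun r => ?_) (by simpa using hcp.add hcp)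
    have := dist_triangle_left (q r) p (c (φ r))
    linarith [hmin r p hpM]
  have hne (r : ℕ) : c (φ r) - q r ≠ 0 := fun h0 => hφM r (sub_eq_zero.1 h0 ▸ hqM r)
  have hsphere (r : ℕ) : ‖c (φ r) - q r‖⁻¹ • (c (φ r) - q r) ∈ Metric.sphere (0 : E m) 1 := by
    simpa using norm_smul_inv_norm (𝕜 := ℝ) (hne r)
  obtain ⟨d, hd1, ψ, hψ, hd⟩ := (isCompact_sphere (0 : E m) 1).tendsto_subseq hsphere
  have hqψ := hqlim.comp hψ.tendsto_atTop
  have hdN : d ∈ normalSpace F p :=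
    hF.mem_normalSpace_of_tendsto (fun r => hqM (ψ r)) (fun r => hmin (ψ r)) hqψ hd
  obtain ⟨ε, hε, hεmem⟩ := exists_pos_add_smul_mem_of_mem_intrinsicInterior hri
    (d := d) (by rw [hspan, AffineSubspace.direction_mk']; exact hdN)
  obtain ⟨u, hu, hulim⟩ := hinner hεmem (q ∘ ψ) (fun r => hqM (ψ r)) hqψ
  have hvψ := (hvlim.comp hφ.tendsto_atTop).comp hψ.tendsto_atTop
  have hlim := (hvψ.sub hulim).inner (𝕜 := ℝ) hd
  have hnonneg : 0 ≤ inner ℝ (vbar - (vbar + ε • d)) d := by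
    refine ge_of_tendsto hlim ?_
    filter_upwards [hu] with r hr
    have := hconv.subdiff_monotone hr (hv (φ (ψ r)))
    simp only [Function.comp_apply] at this ⊢
    rw [inner_smul_right]
    positivity
  rw [sub_add_cancel_left, inner_neg_left, inner_smul_left, real_inner_self_eq_norm_sq,
    mem_sphere_zero_iff_norm.1 hd1] at hnonneg
  simp at hnonneg
  linarith

/-! ### Convergence of approximate multipliers -/

section Multipliers

variable {n m : ℕ} {h : E m → EReal} {c : E n → E m} {xbar : E n}

theorem continuous_gradAdj (hc : ContDiff ℝ 1 c) : Continuous (gradAdj c) :=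
  (ContinuousLinearMap.adjoint (𝕜 := ℝ) (E := E n) (F := E m)).continuous.comp
    (hc.continuous_fderiv (by norm_num))

/-- Limits of bounded multiples of approximate multipliers are annihilated by `∇c(x̄)^*`. -/
theorem gradAdj_eq_zero_of_tendsto (hc : ContDiff ℝ 1 c) {x : ℕ → E n} {v : ℕ → E m}
    {t : ℕ → ℝ} {τ : ℝ} {w : E m} (hx : Tendsto x atTop (𝓝 xbar))
    (hgrad : Tendsto (fun r => gradAdj c (x r) (v r)) atTop (𝓝 0))
    (ht : Tendsto t atTop (𝓝 τ)) (hw : Tendsto (fun r => t r • v r) atTop (𝓝 w)) :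
    gradAdj c xbar w = 0 := by
  have h₁ := tendsto_clm_apply (((continuous_gradAdj hc).tendsto xbar).comp hx) hw
  have h₂ := ht.smul hgrad
  rw [smul_zero] at h₂
  refine tendsto_nhds_unique h₁ (h₂.congr fun r => ?_)
  simp

/-- Under the transversality condition, approximate multipliers converge to the unique
multiplier. -/
theorem ConvexFun.tendsto_multiplier (hconv : ConvexFun h) (hc : ContDiff ℝ 1 c) {vbar : E m}
    (htrans : horizonSubdiff h (c xbar) ∩ {w : E m | gradAdj c xbar w = 0} = {0})
    (hunique : ∀ v : E m, IsMultiplier h c xbar v ↔ v = vbar)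
    {x : ℕ → E n} {cs v : ℕ → E m} (hv : ∀ r, v r ∈ subdiff h (cs r))
    (hx : Tendsto x atTop (𝓝 xbar)) (hcs : Tendsto cs atTop (𝓝 (c xbar)))
    (hh : Tendsto (fun r => h (cs r)) atTop (𝓝 (h (c xbar))))
    (hgrad : Tendsto (fun r => gradAdj c (x r) (v r)) atTop (𝓝 0)) :
    Tendsto v atTop (𝓝 vbar) := by
  have hfin : ∃ a : ℝ, h (c xbar) = a := ((hunique vbar).2 rfl).1.1
  have hreg (r : ℕ) : v r ∈ regularSubdiff h (cs r) :=
    hconv.subdiff_subset_regularSubdiff _ (hv r)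
  have hbdd : ∃ N : ℕ, ∀ᶠ r in atTop, ‖v r‖ ≤ N := by
    by_contra! hcon
    obtain ⟨φ, hφ, hφv⟩ := extraction_forall_of_frequently hcon
    have hpos (r : ℕ) : 0 < ‖v (φ r)‖ := (Nat.cast_nonneg r).trans_lt (hφv r)
    have hinv : Tendsto (fun r => ‖v (φ r)‖⁻¹) atTop (𝓝 0) :=
      (tendsto_atTop_mono (fun r => (hφv r).le) tendsto_natCast_atTop_atTop).inv_tendsto_atTop
    have hsphere (r : ℕ) : ‖v (φ r)‖⁻¹ • v (φ r) ∈ Metric.sphere (0 : E m) 1 := by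
      simpa using norm_smul_inv_norm (𝕜 := ℝ) (norm_pos_iff.1 (hpos r))
    obtain ⟨w, hw1, ψ, hψ, hw⟩ := (isCompact_sphere (0 : E m) 1).tendsto_subseq hsphere
    have hφψ := hφ.tendsto_atTop.comp hψ.tendsto_atTop
    have hinvψ := hinv.comp hψ.tendsto_atTop
    have hw0 : w ∈ ({0} : Set (E m)) := by
      rw [← htrans]
      refine ⟨⟨hfin, _, _, _, hcs.comp hφψ, hh.comp hφψ, fun r => hreg _,
        fun r => inv_pos.2 (hpos (ψ r)), hinvψ, hw⟩, ?_⟩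
      exact gradAdj_eq_zero_of_tendsto hc (hx.comp hφψ) (hgrad.comp hφψ) hinvψ hw
    rw [Set.mem_singleton_iff.1 hw0] at hw1
    simp at hw1
  obtain ⟨N, hN⟩ := hbdd
  refine tendsto_of_subseq_tendsto fun ns hns => ?_
  have hNs : ∀ᶠ r in atTop, v (ns r) ∈ Metric.closedBall (0 : E m) N :=
    (hns.eventually hN).mono fun r hr => by simpa using hr
  obtain ⟨w, -, ψ, hψ, hw⟩ :=
    tendsto_subseq_of_frequently_bounded Metric.isBounded_closedBall hNs.frequently
  have hnsψ := hns.comp hψ.tendsto_atTop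
  have hmult : IsMultiplier h c xbar w := by
    refine ⟨⟨hfin, _, _, hcs.comp hnsψ, hh.comp hnsψ, fun r => hreg _, hw⟩, ?_⟩
    -- No rescaling is needed in the bounded case, hence the constant factor `1`.
    exact gradAdj_eq_zero_of_tendsto hc (t := fun _ => 1) (hx.comp hnsψ) (hgrad.comp hnsψ)
      tendsto_const_nhds (by simpa [Function.comp_def] using hw)
  exact ⟨ψ, (hunique w).1 hmult ▸ hw⟩

end Multipliers

end CompositeOpt

open CompositeOpt in
theorem mainTheorem6 {n m : ℕ} (h : E m → EReal) (c : E n → E m) (xbar : E n) (vbar : E m)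
    (M : Set (E m))
    (h_lsc : LowerSemicontinuous h)
    (c_smooth : ContDiff ℝ 1 c)
    (x_crit : IsCritical (fun x => h (c x)) xbar)
    (transversality :
      horizonSubdiff h (c xbar) ∩ {w : E m | gradAdj c xbar w = 0} = {0})
    (v_unique : ∀ v : E m, IsMultiplier h c xbar v ↔ v = vbar)
    (v_ri : vbar ∈ intrinsicInterior ℝ (subdiff h (c xbar)))
    (h_convex : ConvexFun h)
    (M_closed : IsClosed M)
    (h_partly : PartlySmoothAt h M (c xbar))
    (x : ℕ → E n) (cs v : ℕ → E m)
    (hv : ∀ r, v r ∈ subdiff h (cs r))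
    (hx : Tendsto x atTop (𝓝 xbar))
    (hc : Tendsto (fun r => ‖cs r - c (x r)‖) atTop (𝓝 0))
    (hh : Tendsto (fun r => h (cs r)) atTop (𝓝 (h (c xbar))))
    (hgrad : Tendsto (fun r => gradAdj c (x r) (v r)) atTop (𝓝 0)) :
    ∀ᶠ r in atTop, cs r ∈ M := by
  have hcs : Tendsto cs atTop (𝓝 (c xbar)) := by
    have := (tendsto_zero_iff_norm_tendsto_zero.2 hc).add
      ((c_smooth.continuous.tendsto xbar).comp hx)
    simpa using this
  exact h_partly.eventually_mem h_convex M_closed v_ri hv hcs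
    (h_convex.tendsto_multiplier c_smooth transversality v_unique hv hx hcs hh hgrad)
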